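/- Let $(X,d)$ be a Polish metric space with its Borel $\sigma$-algebra and let $m=(m_x)_{x\in X}$ be a random walk on $X$: Borel probability measures $m_x$ that depend measurably on $x$ and have finite first moments. Let $\nu$ be a Borel probability measure on $X$ that is reversible (hence invariant) for $m$, i.e. $dm_x(y)\,d\nu(x)=dm_y(x)\,d\nu(y)$, and assume that the space is $m$-connected: $\int_A m_x(B)\,d\nu(x)>0$ for all measurable $A,B$ of positive $\nu$-measure with $A\cup B=X$. For $\nu$-measurable $E\subset X$ put $P_m(E)=\int_E m_x(X\setminus E)\,d\nu(x)$ and, if $0<\nu(E)<1$, $\lambda^m_E=P_m(E)/\nu(E)$. A $\nu$-measurable set $\Omega$ with $0<\nu(\Omega)<1$ is called *$m$-calibrable* if $\lambda^m_\Omega=\inf\{P_m(E)/\nu(E): E\subset\Omega\ \nu\text{-measurable},\ \nu(E)>0\}$. The $m$-Cheeger constant of $X$ is $$h_m(X)=\inf\Big\{\frac{P_m(D)}{\min\{\nu(D),\nu(X\setminus D)\}}: D\subset X\ \nu\text{-measurable},\ 0<\nu(D)<1\Big\}.$$ Let $\mathcal F_m(u)=\frac12\int_X\int_X|u(y)-u(x)|\,dm_x(y)\,d\nu(x)\in[0,+\infty]$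 for $u\in L^2(X,\nu)$, let $\partial\mathcal F_m$ be its subdifferential in $L^2(X,\nu)$, and let the $1$-Laplacian be the multivalued operator $\Delta^m_1=-\partial\mathcal F_m$. A pair $(\lambda,u)\in\mathbb R\times L^2(X,\nu)$ is an *$m$-eigenpair* of $\Delta_1^m$ if $\|u\|_{L^1(X,\nu)}=1$ and there is $\xi:X\to\mathbb R$ with $\xi(x)\in\operatorname{sign}(u(x))$ for every $x$ and $\lambda\xi\in\partial\mathcal F_m(u)=-\Delta_1^m u$, where $\operatorname{sign}(r)=\{r/|r|\}$ for $r\ne0$ and $\operatorname{sign}(0)=[-1,1]$; then $\lambda$ is called an *$m$-eigenvalue*. **Theorem.** Let $\Omega\subset X$ be $\nu$-measurable with $0<\nu(\Omega)\le\frac12$. (i) If $\Omega$ and $X\setminus\Omega$ are $m$-calibrable, then $\big(\lambda^m_\Omega,\tfrac1{\nu(\Omega)}\chi_\Omega\big)$ is an $m$-eigenpair of $\Delta_1^m$. (ii) If $h_m(X)=\lambda^m_\Omega$, then $\Omega$ and $X\setminus\Omega$ are $m$-calibrable. (iii) If $h_m(X)=\lambda^m_\Omega$, then $\big(\lambda^m_\Omega,\tfrac1{\nu(\Omega)}\chi_\Omega\big)$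 is an $m$-eigenpair of $\Delta_1^m$. Consequently, whenever the infimum defining $h_m(X)$ is attained, $h_m(X)$ is an $m$-eigenvalue of $\Delta_1^m$. -/

import Mathlib

open MeasureTheory ProbabilityTheory
open scoped ENNReal

namespace MRW

/-- The subdifferential at `u` of a functional `Φ : H → ]-∞, +∞]` on a real Hilbert space:
the set of all `v` with `Φ w ≥ Φ u + ⟨v, w - u⟩` for every `w`. -/
def subdifferential {H : Type*} [NormedAddCommGroup H] [InnerProductSpace ℝ H]
    (Φ : H → EReal) (u : H) : Set H :=
  {v | ∀ w : H, Φ u + ((inner ℝ v (w - u) : ℝ) : EReal) ≤ Φ w}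

/-- The multivalued sign function: `{1}` on positive reals, `{-1}` on negative reals and
`[-1, 1]` at `0`. -/
noncomputable def multiSign (r : ℝ) : Set ℝ :=
  if 0 < r then {1} else if r < 0 then {-1} else Set.Icc (-1) 1

variable {X : Type*} [MeasurableSpace X]

/-- Every jump measure `m x` has finite first moment (with respect to some base point). -/
def HasFiniteFirstMoment [MetricSpace X] (m : Kernel X X) : Prop :=
  ∃ z : X, ∀ x : X, ∫⁻ y, edist z y ∂(m x) < ∞

/-- The `m`-interaction `L_m(A, B) = ∫_A ∫_B dm_x(y) dν(x)`. -/
noncomputable def interaction (m : Kernel X X) (ν : Measure X) (A B : Set X) : ℝ≥0∞ :=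
  ∫⁻ x in A, m x B ∂ν

/-- The space is `m`-connected: any two non-null measurable sets that cover `X` interact. -/
def IsConnected (m : Kernel X X) (ν : Measure X) : Prop :=
  ∀ A B : Set X, MeasurableSet A → MeasurableSet B → 0 < ν A → 0 < ν B →
    A ∪ B = Set.univ → 0 < interaction m ν A B

/-- The `m`-perimeter `P_m(E) = L_m(E, X ∖ E)`. -/
noncomputable def perimeter (m : Kernel X X) (ν : Measure X) (E : Set X) : ℝ≥0∞ :=
  interaction m ν E Eᶜ

/-- The ratio `λ^m_E = P_m(E) / ν(E)`, for `0 < ν(E) < ∞`. -/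
noncomputable def ratio (m : Kernel X X) (ν : Measure X) (E : Set X) : ℝ≥0∞ :=
  perimeter m ν E / ν E

/-- The `m`-Cheeger constant `h_1^m(Ω)` of a set: the infimum of `P_m(E) / ν(E)` over the
`ν`-measurable sets `E ⊆ Ω` of positive measure. -/
noncomputable def setCheeger (m : Kernel X X) (ν : Measure X) (Ω : Set X) : ℝ≥0∞ :=
  sInf {r | ∃ E : Set X, E ⊆ Ω ∧ NullMeasurableSet E ν ∧ 0 < ν E ∧ r = ratio m ν E}

/-- `E` is an `m`-Cheeger set of `Ω`: it achieves the infimum `h_1^m(Ω)`. -/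
def IsCheegerSet (m : Kernel X X) (ν : Measure X) (E Ω : Set X) : Prop :=
  E ⊆ Ω ∧ NullMeasurableSet E ν ∧ 0 < ν E ∧ setCheeger m ν Ω = ratio m ν E

/-- `Ω` is `m`-calibrable: `0 < ν(Ω) < ν(X)` and `Ω` is an `m`-Cheeger set of itself. -/
def IsCalibrable (m : Kernel X X) (ν : Measure X) (Ω : Set X) : Prop :=
  ν Ω < ν Set.univ ∧ IsCheegerSet m ν Ω Ω

/-- The `m`-Cheeger constant `h_m(X)` of the whole space (for a probability measure `ν`): the
infimum of `P_m(D) / min {ν(D), ν(X ∖ D)}` over the `ν`-measurable `D` with `0 < ν(D) < 1`. -/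
noncomputable def spaceCheeger (m : Kernel X X) (ν : Measure X) : ℝ≥0∞ :=
  sInf {r | ∃ D : Set X, NullMeasurableSet D ν ∧ 0 < ν D ∧ ν D < 1 ∧
    r = perimeter m ν D / min (ν D) (ν Dᶜ)}

/-- The `m`-total variation `TV_m(u) = 1/2 ∫∫ |u(y) - u(x)| dm_x(y) dν(x)`; it is `+∞` exactly when
the measurable function `u` is not in `BV_m(X, ν)`. -/
noncomputable def totalVariation (m : Kernel X X) (ν : Measure X) (u : X → ℝ) : ℝ≥0∞ :=
  (1 / 2) * ∫⁻ x, ∫⁻ y, ENNReal.ofReal |u y - u x| ∂(m x) ∂ν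

/-- The functional `F_m : L²(X, ν) → ]-∞, +∞]`, equal to `TV_m` on `L² ∩ BV_m` and to `+∞` on the
rest of `L²`. -/
noncomputable def energy (m : Kernel X X) (ν : Measure X) (u : Lp ℝ 2 ν) : EReal :=
  ((totalVariation m ν u : ℝ≥0∞) : EReal)

/-- The multivalued `1`-Laplacian on `L²(X, ν)`: `v ∈ Δ_1^m u` iff `-v ∈ ∂F_m(u)`. -/
def oneLaplacian (m : Kernel X X) (ν : Measure X) (u : Lp ℝ 2 ν) : Set (Lp ℝ 2 ν) :=
  {v | -v ∈ subdifferential (energy m ν) u}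

/-- `(lam, u)` is an `m`-eigenpair of the `1`-Laplacian: `u ∈ L²(X, ν)`, `‖u‖_{L¹} = 1`, and there
is a selection `ξ` of the multivalued sign of `u` such that `lam ξ ∈ ∂F_m(u) = -Δ_1^m u`. -/
def IsEigenpair (m : Kernel X X) (ν : Measure X) (lam : ℝ) (u : X → ℝ) : Prop :=
  ∃ hu : MemLp u 2 ν, eLpNorm u 1 ν = 1 ∧
    ∃ ξ : X → ℝ, (∀ x, ξ x ∈ multiSign (u x)) ∧
      ∃ hξ : MemLp (fun x => lam * ξ x) 2 ν,
        -(hξ.toLp (fun x => lam * ξ x)) ∈ oneLaplacian m ν (hu.toLp u)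

/-- `lam` is an `m`-eigenvalue of the `1`-Laplacian. -/
def IsEigenvalue (m : Kernel X X) (ν : Measure X) (lam : ℝ) : Prop :=
  ∃ u : X → ℝ, IsEigenpair m ν lam u

end MRW

open Set

namespace MRW

variable {X : Type*} [MeasurableSpace X]

/-! Take `ξ` equal to `1` on `Ω` and `-ν(Ω)/ν(Ωᶜ)` on `Ωᶜ`. It is a sign selection because `ν(Ω) ≤
1/2`, and by reversibility `P(Ω) = P(Ωᶜ)`, so `λ_Ω ξ` is `λ_Ω` on `Ω` and `-λ_{Ωᶜ}` on `Ωᶜ`. Pairing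
it with the normalized indicator gives exactly its energy, so the subgradient inequality reduces to
`⟨λ_Ω ξ, w⟩ ≤ TV(w)` for all `w` (`ofReal_sub_le_totalVariation`). By the coarea formula, applied to
the positive and negative parts of `w`, this reduces to the inequality on sets `λ_Ω ν(E ∩ Ω) ≤ P(E)
+ λ_{Ωᶜ} ν(E ∩ Ωᶜ)` (`ratio_mul_measure_inter_le`), which follows from submodularity of the
perimeter and the two calibrability hypotheses.

Calibrability of a minimizer and of its complement comes from testing the Cheeger quotient on their
subsets. -/

lemma memLp_indicator_const₀ {ν : Measure X} [IsFiniteMeasure ν] {p : ℝ≥0∞} {E : Set X}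
    (hE : NullMeasurableSet E ν) (c : ℝ) : MemLp (E.indicator fun _ => c) p ν := by
  have hc : MemLp (fun _ : X => c) p ν := memLp_const c
  exact ⟨hc.1.indicator₀ hE, (eLpNorm_indicator_le _).trans_lt hc.2⟩

variable {m : Kernel X X} {ν : Measure X}

/-! ### Null sets and the perimeter -/

/-- Invariance writes `ν` as the `ν`-average of the `m x`, so a `ν`-null set is `m x`-null for
almost every `x`. Hence sets and functions may be changed on `ν`-null sets even in the inner
integrals. -/
lemma ae_ae_of_invariant (hinv : m.Invariant ν) {p : X → Prop} (hp : ∀ᵐ x ∂ν, p x) :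
    ∀ᵐ x ∂ν, ∀ᵐ y ∂(m x), p y := by
  rw [← hinv.def] at hp
  exact Measure.ae_ae_of_ae_bind m.aemeasurable hp

lemma interaction_congr_ae (hinv : m.Invariant ν) {A A' B B' : Set X}
    (hA : A =ᵐ[ν] A') (hB : B =ᵐ[ν] B') : interaction m ν A B = interaction m ν A' B' := by
  have h : ∀ᵐ x ∂ν, m x B = m x B' := by
    filter_upwards [ae_ae_of_invariant hinv hB] with x hx using measure_congr hx
  rw [interaction, interaction, Measure.restrict_congr_set hA]
  exact lintegral_congr_ae (ae_restrict_of_ae h)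

lemma perimeter_congr_ae (hinv : m.Invariant ν) {E E' : Set X} (h : E =ᵐ[ν] E') :
    perimeter m ν E = perimeter m ν E' :=
  interaction_congr_ae hinv h h.compl

lemma totalVariation_congr_ae (hinv : m.Invariant ν) {u v : X → ℝ} (h : u =ᵐ[ν] v) :
    totalVariation m ν u = totalVariation m ν v := by
  unfold totalVariation
  congr 1
  refine lintegral_congr_ae ?_
  filter_upwards [h, ae_ae_of_invariant hinv h] with x hx hx'
  refine lintegral_congr_ae ?_
  filter_upwards [hx'] with y hy
  rw [hx, hy]

lemma perimeter_compl [IsMarkovKernel m] (hrev : m.IsReversible ν) {E : Set X}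
    (hE : NullMeasurableSet E ν) : perimeter m ν Eᶜ = perimeter m ν E := by
  obtain ⟨F, hF, hEF⟩ := hE
  rw [perimeter_congr_ae hrev.invariant hEF, perimeter_congr_ae hrev.invariant hEF.compl,
    perimeter, perimeter, compl_compl]
  exact hrev hF.compl hF

lemma perimeter_le_measure [IsMarkovKernel m] (E : Set X) : perimeter m ν E ≤ ν E := by
  calc perimeter m ν E ≤ ∫⁻ _ in E, 1 ∂ν := lintegral_mono fun x => prob_le_one
    _ = ν E := by simp

lemma perimeter_ne_top [IsMarkovKernel m] [IsFiniteMeasure ν] (E : Set X) :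
    perimeter m ν E ≠ ∞ :=
  ((perimeter_le_measure E).trans_lt (measure_lt_top ν E)).ne

lemma perimeter_eq_compProd [IsMarkovKernel m] [SFinite ν] {E : Set X} (hE : MeasurableSet E) :
    perimeter m ν E = (ν ⊗ₘ m) (E ×ˢ Eᶜ) := by
  rw [Measure.compProd_apply_prod hE hE.compl, perimeter, interaction]

/-- The perimeter is submodular. -/
lemma perimeter_inter_add_perimeter_union_le [IsMarkovKernel m] [SFinite ν]
    (hinv : m.Invariant ν) {A B : Set X}
    (hA : NullMeasurableSet A ν) (hB : NullMeasurableSet B ν) :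
    perimeter m ν (A ∩ B) + perimeter m ν (A ∪ B) ≤ perimeter m ν A + perimeter m ν B := by
  obtain ⟨A', hA', hAA'⟩ := hA
  obtain ⟨B', hB', hBB'⟩ := hB
  rw [perimeter_congr_ae hinv (hAA'.inter hBB'), perimeter_congr_ae hinv (hAA'.union hBB'),
    perimeter_congr_ae hinv hAA', perimeter_congr_ae hinv hBB',
    perimeter_eq_compProd (hA'.inter hB'), perimeter_eq_compProd (hA'.union hB'),
    perimeter_eq_compProd hA', perimeter_eq_compProd hB',
    ← measure_union_add_inter ((A' ∩ B') ×ˢ (A' ∩ B')ᶜ) ((hA'.union hB').prod (hA'.union hB').compl),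
    ← measure_union_add_inter (A' ×ˢ A'ᶜ) (hB'.prod hB'.compl)]
  -- A jump leaving `A' ∩ B'` or `A' ∪ B'` leaves `A'` or `B'`; a jump leaving both of the former
  -- leaves both of the latter.
  refine add_le_add (measure_mono ?_) (measure_mono ?_)
  · rintro ⟨x, y⟩
    simp only [mem_union, mem_prod, mem_inter_iff, mem_compl_iff]
    tauto
  · rintro ⟨x, y⟩
    simp only [mem_union, mem_prod, mem_inter_iff, mem_compl_iff]
    tauto

/-! ### Total variation and coarea -/

lemma measurable_lintegral_abs_sub [IsMarkovKernel m] {u : X → ℝ} (hu : Measurable u) :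
    Measurable fun x => ∫⁻ y, ENNReal.ofReal |u y - u x| ∂(m x) := by
  refine Measurable.lintegral_kernel_prod_right' (f := fun p : X × X =>
    ENNReal.ofReal |u p.2 - u p.1|) ?_
  fun_prop

lemma totalVariation_eq_lintegral_compProd [IsMarkovKernel m] [SFinite ν] {u : X → ℝ}
    (hu : Measurable u) :
    totalVariation m ν u = (1 / 2) * ∫⁻ p, ENNReal.ofReal |u p.2 - u p.1| ∂(ν ⊗ₘ m) := by
  rw [totalVariation, Measure.lintegral_compProd (by fun_prop)]

/-- Jumps out of `E` and jumps into `E` contribute equally by reversibility, which absorbs the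
factor `1/2`. -/
lemma totalVariation_indicator_one [IsMarkovKernel m] [SFinite ν] (hrev : m.IsReversible ν)
    {E : Set X} (hE : MeasurableSet E) :
    totalVariation m ν (E.indicator fun _ => 1) = perimeter m ν E := by
  have hpt : ∀ p : X × X, ENNReal.ofReal |E.indicator (fun _ => (1 : ℝ)) p.2 -
      E.indicator (fun _ => (1 : ℝ)) p.1| =
      (E ×ˢ Eᶜ).indicator 1 p + (Eᶜ ×ˢ Eᶜᶜ).indicator 1 p := by
    rintro ⟨x, y⟩
    by_cases hx : x ∈ E <;> by_cases hy : y ∈ E <;> simp [hx, hy]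
  rw [totalVariation_eq_lintegral_compProd (measurable_const.indicator hE)]
  simp_rw [hpt]
  rw [lintegral_add_left (measurable_one.indicator (hE.prod hE.compl)),
    lintegral_indicator_one (hE.prod hE.compl), lintegral_indicator_one (hE.compl.prod hE.compl.compl),
    ← perimeter_eq_compProd hE, ← perimeter_eq_compProd hE.compl,
    perimeter_compl hrev hE.nullMeasurableSet, ← two_mul, ← mul_assoc, one_div,
    ENNReal.inv_mul_cancel two_ne_zero ENNReal.ofNat_ne_top, one_mul]

lemma totalVariation_const_mul [IsMarkovKernel m] {u : X → ℝ} (hu : Measurable u) (c : ℝ) :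
    totalVariation m ν (fun x => c * u x) = ENNReal.ofReal |c| * totalVariation m ν u := by
  simp_rw [totalVariation, ← mul_sub, abs_mul, ENNReal.ofReal_mul (abs_nonneg c)]
  have h : ∀ x, ∫⁻ y, ENNReal.ofReal |c| * ENNReal.ofReal |u y - u x| ∂(m x) =
      ENNReal.ofReal |c| * ∫⁻ y, ENNReal.ofReal |u y - u x| ∂(m x) := fun x =>
    lintegral_const_mul _ (by fun_prop)
  simp_rw [h]
  rw [lintegral_const_mul _ (measurable_lintegral_abs_sub hu), mul_left_comm]

lemma totalVariation_indicator_const [IsMarkovKernel m] [SFinite ν] (hrev : m.IsReversible ν)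
    {E : Set X} (hE : NullMeasurableSet E ν) (c : ℝ) :
    totalVariation m ν (E.indicator fun _ => c) = ENNReal.ofReal |c| * perimeter m ν E := by
  obtain ⟨F, hF, hEF⟩ := hE
  rw [totalVariation_congr_ae hrev.invariant (indicator_ae_eq_of_ae_eq_set hEF),
    perimeter_congr_ae hrev.invariant hEF, ← totalVariation_indicator_one hrev hF,
    ← totalVariation_const_mul (measurable_const.indicator hF)]
  congr 1
  ext x
  by_cases hx : x ∈ F <;> simp [hx]

/-- Pointwise, `|b - a| = |b⁺ - a⁺| + |b⁻ - a⁻|`. This reduces real functions to nonnegative ones.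
-/
lemma totalVariation_eq_posPart_add_negPart [IsMarkovKernel m] [SFinite ν] {u : X → ℝ}
    (hu : Measurable u) :
    totalVariation m ν u =
      totalVariation m ν (fun x => max (u x) 0) + totalVariation m ν (fun x => max (-u x) 0) := by
  rw [totalVariation_eq_lintegral_compProd hu, totalVariation_eq_lintegral_compProd (by fun_prop),
    totalVariation_eq_lintegral_compProd (by fun_prop), ← mul_add,
    ← lintegral_add_left (by fun_prop)]
  congr 1
  refine lintegral_congr fun p => ?_
  rw [← ENNReal.ofReal_add (abs_nonneg _) (abs_nonneg _)]
  congr 1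
  grind

/-- The distance between `a` and `b` is the length of the set of levels separating them. -/
lemma ofReal_abs_sub_eq_lintegral {a b : ℝ} (ha : 0 ≤ a) (hb : 0 ≤ b) :
    ENNReal.ofReal |b - a| = ∫⁻ t in Ioi (0 : ℝ),
      ENNReal.ofReal |(if t < b then 1 else 0) - (if t < a then (1 : ℝ) else 0)| := by
  have hpt : ∀ t : ℝ, ENNReal.ofReal
      |(if t < b then 1 else 0) - (if t < a then (1 : ℝ) else 0)| =
      (Ico (min a b) (max a b)).indicator 1 t := by
    intro t
    by_cases h1 : t < a <;> by_cases h2 : t < b <;>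
      simp [h1, h2, indicator, not_lt.1]
  simp_rw [hpt]
  -- `min a b` may be `0`, so the level `0` is added, at no cost in measure.
  rw [Measure.restrict_congr_set Ioi_ae_eq_Ici, lintegral_indicator_one measurableSet_Ico,
    Measure.restrict_apply measurableSet_Ico,
    inter_eq_left.2 (Ico_subset_Ici_self.trans (Ici_subset_Ici.2 (le_min ha hb))), Real.volume_Ico, max_sub_min_eq_abs]

/-- The coarea formula for nonnegative functions. -/
lemma totalVariation_eq_lintegral_perimeter [IsMarkovKernel m] [SFinite ν]
    (hrev : m.IsReversible ν) {f : X → ℝ} (hf : Measurable f) (h0 : ∀ x, 0 ≤ f x) :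
    totalVariation m ν f = ∫⁻ t in Ioi (0 : ℝ), perimeter m ν {x | t < f x} := by
  have hE : ∀ t, MeasurableSet {x | t < f x} := fun t => measurableSet_lt measurable_const hf
  have hmeas : Measurable (Function.uncurry fun (p : X × X) (t : ℝ) =>
      ENNReal.ofReal |(if t < f p.2 then 1 else 0) - (if t < f p.1 then (1 : ℝ) else 0)|) := by
    refine ENNReal.measurable_ofReal.comp (continuous_abs.measurable.comp (Measurable.sub ?_ ?_))
    · exact Measurable.ite (measurableSet_lt (by fun_prop) (by fun_prop)) measurable_const
        measurable_const
    · exact Measurable.ite (measurableSet_lt (by fun_prop) (by fun_prop)) measurable_const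
        measurable_const
  rw [totalVariation_eq_lintegral_compProd hf]
  simp_rw [fun p : X × X => ofReal_abs_sub_eq_lintegral (h0 p.1) (h0 p.2)]
  rw [lintegral_lintegral_swap hmeas.aemeasurable, ← lintegral_const_mul _ (by
    exact Measurable.lintegral_prod_left hmeas)]
  refine lintegral_congr fun t => ?_
  rw [← totalVariation_indicator_one hrev (hE t),
    totalVariation_eq_lintegral_compProd (measurable_const.indicator (hE t))]
  simp only [indicator, mem_ofPred_eq]

/-- The hypothesis on superlevel sets is integrated over the level, by coarea and the layer cake
formula. The `b` term stays on the right to avoid truncated subtraction. -/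
lemma mul_lintegral_le_totalVariation_add [IsMarkovKernel m] [SFinite ν]
    (hrev : m.IsReversible ν) {A B : Set X} {a b : ℝ≥0∞}
    (h : ∀ E, MeasurableSet E → a * ν (E ∩ A) ≤ perimeter m ν E + b * ν (E ∩ B))
    {f : X → ℝ} (hf : Measurable f) (h0 : ∀ x, 0 ≤ f x) :
    a * ∫⁻ x in A, ENNReal.ofReal (f x) ∂ν ≤
      totalVariation m ν f + b * ∫⁻ x in B, ENNReal.ofReal (f x) ∂ν := by
  have hE : ∀ t, MeasurableSet {x | t < f x} := fun t => measurableSet_lt measurable_const hf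
  have hmeas : ∀ A : Set X, Measurable fun t => (ν.restrict A) {x | t < f x} := fun A =>
    Antitone.measurable fun s t hst => measure_mono fun x hx => hst.trans_lt hx
  rw [totalVariation_eq_lintegral_perimeter hrev hf h0,
    lintegral_eq_lintegral_meas_lt _ (Filter.Eventually.of_forall h0) hf.aemeasurable,
    lintegral_eq_lintegral_meas_lt _ (Filter.Eventually.of_forall h0) hf.aemeasurable,
    ← lintegral_const_mul _ (hmeas A), ← lintegral_const_mul _ (hmeas B),
    ← lintegral_add_right _ ((hmeas B).const_mul b)]
  refine lintegral_mono fun t => ?_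
  simp only [Measure.restrict_apply (hE t)]
  exact h _ (hE t)

/-! ### Calibrable sets and eigenpairs -/

lemma ratio_mul_measure [IsFiniteMeasure ν] {Ω : Set X} (h0 : 0 < ν Ω) :
    ratio m ν Ω * ν Ω = perimeter m ν Ω :=
  ENNReal.div_mul_cancel h0.ne' (measure_ne_top _ _)

lemma ratio_ne_top [IsMarkovKernel m] [IsFiniteMeasure ν] {Ω : Set X} (h0 : 0 < ν Ω) :
    ratio m ν Ω ≠ ∞ :=
  ENNReal.div_ne_top (perimeter_ne_top Ω) h0.ne'

lemma IsCalibrable.ratio_mul_measure_le [IsFiniteMeasure ν] {Ω E : Set X}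
    (h : IsCalibrable m ν Ω) (hE : NullMeasurableSet E ν) (hEΩ : E ⊆ Ω) :
    ratio m ν Ω * ν E ≤ perimeter m ν E := by
  rcases eq_zero_or_pos (ν E) with h0 | h0
  · simp [h0]
  · rw [← ratio_mul_measure h0, ← h.2.2.2.2]
    gcongr
    exact sInf_le ⟨E, hEΩ, hE, h0, rfl⟩

/-- Calibrability bounds `P(E ∩ Ω)` and `P(E ∪ Ω) = P(Eᶜ ∩ Ωᶜ)` from below; submodularity bounds
their sum by `P(E) + P(Ω)`, and the finite `P(Ω)` cancels. -/
lemma ratio_mul_measure_inter_le [IsMarkovKernel m] [IsFiniteMeasure ν] (hrev : m.IsReversible ν)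
    {Ω : Set X} (h : IsCalibrable m ν Ω) (h' : IsCalibrable m ν Ωᶜ) {E : Set X}
    (hE : MeasurableSet E) :
    ratio m ν Ω * ν (E ∩ Ω) ≤ perimeter m ν E + ratio m ν Ωᶜ * ν (E ∩ Ωᶜ) := by
  have hΩ : NullMeasurableSet Ω ν := h.2.2.1
  have hE' := hE.nullMeasurableSet (μ := ν)
  have h1 := h.ratio_mul_measure_le (hE'.inter hΩ) inter_subset_right
  have h2 := h'.ratio_mul_measure_le (hE'.compl.inter hΩ.compl) inter_subset_right
  rw [← compl_union, perimeter_compl hrev (hE'.union hΩ), compl_union] at h2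
  have h3 := perimeter_inter_add_perimeter_union_le hrev.invariant hE' hΩ
  have h4 : perimeter m ν Ω = ratio m ν Ωᶜ * ν (E ∩ Ωᶜ) + ratio m ν Ωᶜ * ν (Eᶜ ∩ Ωᶜ) := by
    rw [← perimeter_compl hrev hΩ, ← ratio_mul_measure h'.2.2.2.1, ← mul_add, inter_comm E,
      inter_comm Eᶜ, ← sdiff_eq, measure_inter_add_sdiff _ hE]
  refine (ENNReal.add_le_add_iff_right (perimeter_ne_top (m := m) (ν := ν) Ω)).1 ?_
  calc ratio m ν Ω * ν (E ∩ Ω) + perimeter m ν Ω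
      ≤ perimeter m ν (E ∩ Ω) +
        (ratio m ν Ωᶜ * ν (E ∩ Ωᶜ) + perimeter m ν (E ∪ Ω)) := by
        rw [h4]; gcongr
    _ = perimeter m ν (E ∩ Ω) + perimeter m ν (E ∪ Ω) + ratio m ν Ωᶜ * ν (E ∩ Ωᶜ) := by ring
    _ ≤ perimeter m ν E + perimeter m ν Ω + ratio m ν Ωᶜ * ν (E ∩ Ωᶜ) := by gcongr
    _ = _ := by ring

/-- If `Ω` and its complement are calibrable, then pairing with the function equal to
`λ_Ω` on `Ω` and to `-λ_{Ωᶜ}` on `Ωᶜ` is dominated by the total variation. -/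
lemma ofReal_sub_le_totalVariation [IsMarkovKernel m] [IsFiniteMeasure ν]
    (hrev : m.IsReversible ν) {Ω : Set X} (h : IsCalibrable m ν Ω) (h' : IsCalibrable m ν Ωᶜ)
    {w : X → ℝ} (hw : Measurable w) (hwi : Integrable w ν) :
    ENNReal.ofReal ((ratio m ν Ω).toReal * ∫ x in Ω, w x ∂ν -
      (ratio m ν Ωᶜ).toReal * ∫ x in Ωᶜ, w x ∂ν) ≤ totalVariation m ν w := by
  by_cases htop : totalVariation m ν w = ∞
  · simp [htop]
  have hl := ratio_ne_top (m := m) h.2.2.2.1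
  have hl' := ratio_ne_top (m := m) h'.2.2.2.1
  have hsplit := totalVariation_eq_posPart_add_negPart (m := m) (ν := ν) hw
  have hpos := mul_lintegral_le_totalVariation_add hrev
    (fun E hE => ratio_mul_measure_inter_le hrev h h' hE) (hw.max measurable_const)
    (fun x => le_max_right (w x) 0)
  -- For the negative part, `Ω` and `Ωᶜ` exchange roles.
  have hneg := mul_lintegral_le_totalVariation_add hrev
    (fun E hE => ratio_mul_measure_inter_le hrev h' (by rwa [compl_compl]) hE)
    (hw.neg.max measurable_const) (fun x => le_max_right (-w x) 0)
  simp only [compl_compl, ENNReal.ofReal_max, ENNReal.ofReal_zero, zero_le, max_eq_left,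
    Pi.neg_apply] at hpos hneg
  have hfin : ∀ (v : X → ℝ) (A : Set X), Integrable v ν →
      ∫⁻ x in A, ENNReal.ofReal (v x) ∂ν ≠ ∞ := fun v A hv =>
    (hv.restrict (s := A)).lintegral_lt_top.ne
  rw [hsplit] at htop ⊢
  obtain ⟨ht1, ht2⟩ := ENNReal.add_ne_top.1 htop
  rw [integral_eq_lintegral_pos_part_sub_lintegral_neg_part hwi.restrict,
    integral_eq_lintegral_pos_part_sub_lintegral_neg_part hwi.restrict]
  refine ENNReal.ofReal_le_of_le_toReal ?_
  have e1 := ENNReal.toReal_mono (ENNReal.add_ne_top.2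
    ⟨ht1, ENNReal.mul_ne_top hl' (hfin w Ωᶜ hwi)⟩) hpos
  have e2 := ENNReal.toReal_mono (ENNReal.add_ne_top.2
    ⟨ht2, ENNReal.mul_ne_top hl (hfin (fun x => -w x) Ω hwi.neg)⟩) hneg
  rw [ENNReal.toReal_add ht1 (ENNReal.mul_ne_top hl' (hfin w Ωᶜ hwi)), ENNReal.toReal_mul,
    ENNReal.toReal_mul] at e1
  rw [ENNReal.toReal_add ht2 (ENNReal.mul_ne_top hl (hfin (fun x => -w x) Ω hwi.neg)),
    ENNReal.toReal_mul, ENNReal.toReal_mul] at e2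
  rw [ENNReal.toReal_add ht1 ht2]
  linarith

/-- If `ν Ω ≤ 1 / 2` and both `Ω` and `Ωᶜ` are calibrable, then the normalized characteristic
function of `Ω` is an eigenfunction with eigenvalue `λ_Ω`. -/
theorem IsCalibrable.isEigenpair [IsMarkovKernel m] [IsProbabilityMeasure ν]
    (hrev : m.IsReversible ν) {Ω : Set X} (hhalf : ν Ω ≤ 1 / 2)
    (h : IsCalibrable m ν Ω) (h' : IsCalibrable m ν Ωᶜ) :
    IsEigenpair m ν (ratio m ν Ω).toReal (Ω.indicator fun _ => 1 / ν.real Ω) := by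
  classical
  have hΩ : NullMeasurableSet Ω ν := h.2.2.1
  have ha : 0 < ν.real Ω := ENNReal.toReal_pos h.2.2.2.1.ne' (measure_ne_top _ _)
  have hb : 0 < ν.real Ωᶜ := ENNReal.toReal_pos h'.2.2.2.1.ne' (measure_ne_top _ _)
  have hab : ν.real Ω + ν.real Ωᶜ = 1 := by
    rw [measureReal_add_measureReal_compl₀ hΩ, probReal_univ]
  have hle : ν.real Ω ≤ ν.real Ωᶜ := by
    have := ENNReal.toReal_mono (by simp) hhalf
    rw [← measureReal_def] at this
    norm_num at this
    linarith
  have hratio : (ratio m ν Ωᶜ).toReal = (ratio m ν Ω).toReal * (ν.real Ω / ν.real Ωᶜ) := by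
    rw [ratio, ratio, perimeter_compl hrev hΩ, ENNReal.toReal_div, ENNReal.toReal_div,
      ← measureReal_def, ← measureReal_def]
    field_simp
  set l := (ratio m ν Ω).toReal
  set l' := (ratio m ν Ωᶜ).toReal
  have hu : MemLp (Ω.indicator fun _ => 1 / ν.real Ω) 2 ν :=
    memLp_indicator_const₀ hΩ _
  -- The value on `Ωᶜ` is forced by `l * ξ = -l'` when `l ≠ 0`, in view of `hratio`.
  set ξ : X → ℝ := fun x => if x ∈ Ω then 1 else -(ν.real Ω / ν.real Ωᶜ) with hξdef
  have hξeq : (fun x => l * ξ x) =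
      Ω.indicator (fun _ => l) - Ωᶜ.indicator (fun _ => l') := by
    ext x
    by_cases hx : x ∈ Ω <;> simp [hξdef, hx, hratio]
  have hξ : MemLp (fun x => l * ξ x) 2 ν := by
    rw [hξeq]
    exact (memLp_indicator_const₀ hΩ _).sub (memLp_indicator_const₀ hΩ.compl _)
  have hinner : ∀ w : Lp ℝ 2 ν, inner ℝ (hξ.toLp _) w =
      l * ∫ x in Ω, w x ∂ν - l' * ∫ x in Ωᶜ, w x ∂ν := by
    intro w
    have hwi : Integrable w ν := (Lp.memLp w).integrable one_le_two
    rw [L2.inner_def, ← integral_const_mul, ← integral_const_mul, ← integral_indicator₀ hΩ,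
      ← integral_indicator₀ hΩ.compl, ← integral_sub ((hwi.const_mul l).indicator₀ hΩ)
        ((hwi.const_mul l').indicator₀ hΩ.compl)]
    refine integral_congr_ae ?_
    filter_upwards [hξ.coeFn_toLp] with x hx
    rw [hx, congrFun hξeq x]
    by_cases hx : x ∈ Ω <;> simp [hx, mul_comm]
  have huint : inner ℝ (hξ.toLp _) (hu.toLp _) = l := by
    rw [hinner, setIntegral_congr_ae₀ (g := fun _ => 1 / ν.real Ω) hΩ ?_,
      setIntegral_congr_ae₀ (g := fun _ => 0) hΩ.compl ?_]
    · simp [ha.ne']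
    · filter_upwards [hu.coeFn_toLp] with x hx hxΩ
      rw [hx, indicator_of_notMem hxΩ]
    · filter_upwards [hu.coeFn_toLp] with x hx hxΩ
      rw [hx, indicator_of_mem hxΩ]
  have henergy : energy m ν (hu.toLp _) = ((l : ℝ) : EReal) := by
    rw [energy, totalVariation_congr_ae hrev.invariant hu.coeFn_toLp,
      totalVariation_indicator_const hrev hΩ, abs_of_pos (by positivity), one_div,
      ENNReal.ofReal_inv_of_pos ha, ofReal_measureReal, mul_comm, ← div_eq_mul_inv]
    exact (EReal.coe_ennreal_toReal (ratio_ne_top h.2.2.2.1)).symm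
  refine ⟨hu, ?_, ξ, ?_, hξ, ?_⟩
  · rw [eLpNorm_one_eq_lintegral_enorm]
    simp_rw [enorm_indicator_eq_indicator_enorm]
    rw [lintegral_indicator_const₀ hΩ, Real.enorm_of_nonneg (by positivity), one_div,
      ENNReal.ofReal_inv_of_pos ha, ofReal_measureReal,
      ENNReal.inv_mul_cancel h.2.2.2.1.ne' (measure_ne_top _ _)]
  · intro x
    by_cases hx : x ∈ Ω
    · simp [multiSign, hξdef, hx, ha]
    · have h1 : ν.real Ω / ν.real Ωᶜ ≤ 1 := (div_le_one hb).2 hle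
      have h2 : 0 ≤ ν.real Ω / ν.real Ωᶜ := by positivity
      simp only [multiSign, hξdef, hx, not_false_eq_true, indicator_of_notMem, lt_irrefl,
        if_false, mem_Icc]
      constructor <;> linarith
  · simp only [oneLaplacian, subdifferential, mem_ofPred_eq, neg_neg]
    intro w
    -- The energy of `u` and its pairing with `l * ξ` are both `l` and cancel, leaving `⟨l ξ, w⟩ ≤
    -- TV(w)`.
    rw [henergy, inner_sub_right, huint, ← EReal.coe_add, add_sub_cancel, hinner]
    exact (EReal.coe_le_coe_iff.2 (Real.le_coe_toNNReal _)).trans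
      (EReal.coe_ennreal_le_coe_ennreal_iff.2 (ofReal_sub_le_totalVariation hrev h h'
        (Lp.stronglyMeasurable w).measurable ((Lp.memLp w).integrable one_le_two)))

/-! ### Sets attaining the Cheeger constant -/

lemma spaceCheeger_mul_min_le [IsProbabilityMeasure ν] {D : Set X}
    (hD : NullMeasurableSet D ν) :
    spaceCheeger m ν * min (ν D) (ν Dᶜ) ≤ perimeter m ν D := by
  by_cases h0 : min (ν D) (ν Dᶜ) = 0
  · simp [h0]
  obtain ⟨h1, h2⟩ := lt_min_iff.1 (pos_iff_ne_zero.2 h0)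
  have hlt : ν D < 1 := by
    refine prob_le_one.lt_of_ne fun h => h2.ne' ?_
    exact (prob_compl_eq_zero_iff₀ hD).2 h
  refine ENNReal.mul_le_of_le_div ?_
  exact sInf_le ⟨D, hD, h1, hlt, rfl⟩

/-- A set of measure at most `1 / 2` attaining the Cheeger constant of the space is calibrable, and
so is its complement. -/
theorem isCalibrable_of_spaceCheeger_eq_ratio [IsMarkovKernel m] [IsProbabilityMeasure ν]
    (hrev : m.IsReversible ν) {Ω : Set X} (hΩ : NullMeasurableSet Ω ν) (h0 : 0 < ν Ω)
    (hhalf : ν Ω ≤ 1 / 2) (h : spaceCheeger m ν = ratio m ν Ω) :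
    IsCalibrable m ν Ω ∧ IsCalibrable m ν Ωᶜ := by
  have hadd : ∀ E, NullMeasurableSet E ν → ν E + ν Eᶜ = 1 := fun E hE => by
    rw [measure_add_measure_compl₀ hE, measure_univ]
  have hΩc : 1 / 2 ≤ ν Ωᶜ := by
    by_contra! hlt
    have := ENNReal.add_lt_add_of_le_of_lt (measure_ne_top ν Ω) hhalf hlt
    rw [hadd Ω hΩ, ENNReal.add_halves] at this
    exact this.false
  have hle : ν Ω ≤ ν Ωᶜ := hhalf.trans hΩc
  have h0' : 0 < ν Ωᶜ := h0.trans_le hle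
  have hcal : ∀ A : Set X, NullMeasurableSet A ν → 0 < ν A → ν A < 1 →
      (∀ E ⊆ A, NullMeasurableSet E ν → 0 < ν E → ratio m ν A ≤ ratio m ν E) →
      IsCalibrable m ν A := by
    intro A hA hA0 hA1 hAE
    refine ⟨by rwa [measure_univ], Subset.rfl, hA, hA0, le_antisymm ?_ ?_⟩
    · exact sInf_le ⟨A, Subset.rfl, hA, hA0, rfl⟩
    · refine le_sInf ?_
      rintro r ⟨E, hEA, hE, hE0, rfl⟩
      exact hAE E hEA hE hE0
  refine ⟨hcal Ω hΩ h0 (hhalf.trans_lt (one_div (2 : ℝ≥0∞) ▸ ENNReal.one_half_lt_one)) ?_, hcal Ωᶜ hΩ.compl h0' ?_ ?_⟩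
  · intro E hEΩ hE hE0
    have h1 := spaceCheeger_mul_min_le (m := m) hE
    rw [min_eq_left ((measure_mono hEΩ).trans (hle.trans (measure_mono (compl_subset_compl.2 hEΩ)))),
      h] at h1
    exact (ENNReal.le_div_iff_mul_le (Or.inl hE0.ne') (Or.inl (measure_ne_top _ _))).2 h1
  · refine prob_le_one.lt_of_ne fun h => h0.ne' ?_
    have := (prob_compl_eq_zero_iff₀ hΩ.compl).2 h
    rwa [compl_compl] at this
  · intro E hEΩ hE hE0
    have h1 := spaceCheeger_mul_min_le (m := m) hE
    rcases min_choice (ν E) (ν Eᶜ) with h2 | h2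
    -- `E` is the smaller side: `λ_{Ωᶜ} ≤ λ_Ω = h_m(X) ≤ λ_E`.
    · rw [h2, h] at h1
      calc ratio m ν Ωᶜ ≤ ratio m ν Ω := by
            rw [ratio, ratio, perimeter_compl hrev hΩ]
            gcongr
        _ ≤ ratio m ν E :=
          (ENNReal.le_div_iff_mul_le (Or.inl hE0.ne') (Or.inl (measure_ne_top _ _))).2 h1
    -- `Eᶜ` is the smaller side and contains `Ω`, so `P(E) ≥ λ_Ω ν(Eᶜ) ≥ P(Ω)`, while `ν(E) ≤
    -- ν(Ωᶜ)`.
    · have h3 : perimeter m ν Ω ≤ perimeter m ν E := by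
        rw [h2, h] at h1
        rw [← ratio_mul_measure h0]
        refine le_trans ?_ h1
        gcongr
        exact subset_compl_comm.1 hEΩ
      rw [ratio, ratio, perimeter_compl hrev hΩ]
      gcongr

theorem isEigenvalue_spaceCheeger [IsMarkovKernel m] [IsProbabilityMeasure ν]
    (hrev : m.IsReversible ν) {D : Set X} (hD : NullMeasurableSet D ν) (h0 : 0 < ν D)
    (h1 : ν D < 1) (h : spaceCheeger m ν = perimeter m ν D / min (ν D) (ν Dᶜ)) :
    IsEigenvalue m ν (spaceCheeger m ν).toReal := by
  have key : ∀ Ω : Set X, NullMeasurableSet Ω ν → 0 < ν Ω → ν Ω ≤ ν Ωᶜ →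
      spaceCheeger m ν = ratio m ν Ω → IsEigenvalue m ν (spaceCheeger m ν).toReal := by
    intro Ω hΩ hΩ0 hle hr
    have hhalf : ν Ω ≤ 1 / 2 := by
      rw [ENNReal.le_div_iff_mul_le (by simp) (by simp), mul_two]
      calc ν Ω + ν Ω ≤ ν Ω + ν Ωᶜ := by gcongr
        _ = 1 := by rw [measure_add_measure_compl₀ hΩ, measure_univ]
    obtain ⟨hc, hc'⟩ := isCalibrable_of_spaceCheeger_eq_ratio hrev hΩ hΩ0 hhalf hr
    exact ⟨_, hr ▸ hc.isEigenpair hrev hhalf hc'⟩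
  -- `D` and `Dᶜ` have the same Cheeger quotient, so the one of smaller measure serves as `Ω`.
  rcases le_total (ν D) (ν Dᶜ) with hle | hle
  · exact key D hD h0 hle (by rw [h, min_eq_left hle, ratio])
  · refine key Dᶜ hD.compl ?_ (by rwa [compl_compl]) ?_
    · exact pos_iff_ne_zero.2 fun hz => h1.ne ((prob_compl_eq_zero_iff₀ hD).1 hz)
    · rw [h, min_eq_right hle, ratio, perimeter_compl hrev hD]

end MRW


theorem theorem6p12 {X : Type*} [MetricSpace X] [PolishSpace X] [MeasurableSpace X] [BorelSpace X]
    (m : Kernel X X) [IsMarkovKernel m] (hm : MRW.HasFiniteFirstMoment m)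
    (ν : Measure X) [IsProbabilityMeasure ν] (hν : m.IsReversible ν)
    (hconn : MRW.IsConnected m ν) :
    (∀ Ω : Set X, NullMeasurableSet Ω ν → 0 < ν Ω → ν Ω ≤ 1 / 2 →
      (MRW.IsCalibrable m ν Ω → MRW.IsCalibrable m ν Ωᶜ →
        MRW.IsEigenpair m ν (MRW.ratio m ν Ω).toReal (Ω.indicator fun _ => 1 / ν.real Ω)) ∧
      (MRW.spaceCheeger m ν = MRW.ratio m ν Ω →
        MRW.IsCalibrable m ν Ω ∧ MRW.IsCalibrable m ν Ωᶜ) ∧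
      (MRW.spaceCheeger m ν = MRW.ratio m ν Ω →
        MRW.IsEigenpair m ν (MRW.ratio m ν Ω).toReal (Ω.indicator fun _ => 1 / ν.real Ω))) ∧
    ((∃ D : Set X, NullMeasurableSet D ν ∧ 0 < ν D ∧ ν D < 1 ∧
        MRW.spaceCheeger m ν = MRW.perimeter m ν D / min (ν D) (ν Dᶜ)) →
      MRW.IsEigenvalue m ν (MRW.spaceCheeger m ν).toReal) := by
  refine ⟨fun Ω hΩ h0 hhalf => ⟨fun h h' => h.isEigenpair hν hhalf h', fun h =>
    MRW.isCalibrable_of_spaceCheeger_eq_ratio hν hΩ h0 hhalf h, fun h => ?_⟩, ?_⟩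
  · obtain ⟨hc, hc'⟩ := MRW.isCalibrable_of_spaceCheeger_eq_ratio hν hΩ h0 hhalf h
    exact hc.isEigenpair hν hhalf hc'
  · rintro ⟨D, hD, h0, h1, h⟩
    exact MRW.isEigenvalue_spaceCheeger hν hD h0 h1 h
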